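/- For a partition $\lambda=(\lambda_1\ge\lambda_2\ge\dots)$ of $n=|\lambda|$, a standard Young tableau of shape $\lambda$ is a filling of the Ferrers diagram of $\lambda$ with the numbers $1,\dots,n$, each used exactly once, such that every row and every column is increasing. A tableau $T$ has a descent at $i$ if the entry $i+1$ lies strictly south (and weakly to the west) of $i$ in $T$; let $D(T)$ be the set of descents of $T$. For a function $f$ on the positive integers put $d_f(T)=\sum_{i\in D(T)} f(i)$, and let $E_\lambda(d_f)$ and $V_\lambda(d_f)$ be the expectation and the variance of $d_f$ over a uniformly random standard Young tableau of shape $\lambda$. **Theorem.** Let $f\colon\{1,2,3,\dots\}\to(0,\infty)$ and let $(\lambda^m)_{m\ge1}$ be a sequence of partitions with $|\lambda^m|\ge 2$ for all $m$. Then the quotients $V_{\lambda^m}(d_f)/E_{\lambda^m}(d_f)^2$ are all defined (that is, $E_{\lambda^m}(d_f)\ne0$ for all $m$) and form a bounded sequence if and only if there is a constant $c$, independent of $m$, such that for all $m$ $$ n\sum_{i=1}^{n-1} f(i)^2\;\le\; c\,(n-\lambda^m_1)\Bigl(\sum_{i=1}^{n-1} f(i)\Bigr)^2,\qquad\text{where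 } n=|\lambda^m|.$$ -/

import Mathlib

/-- A standard Young tableau of shape `μ`: a bijective filling of the cells `(row, column)` of `μ`
with the numbers `1, …, |μ|`, strictly increasing along every row and down every column. -/
structure StandardYoungTableau (μ : YoungDiagram) where
  /-- The filling. -/
  entry : {c : ℕ × ℕ // c ∈ μ.cells} ≃ {i : ℕ // i ∈ Finset.Icc 1 μ.card}
  /-- Rows increase from left to right. -/
  row_lt : ∀ c d : {c : ℕ × ℕ // c ∈ μ.cells},
    c.1.1 = d.1.1 → c.1.2 < d.1.2 → (entry c : ℕ) < entry d
  /-- Columns increase from top to bottom. -/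
  col_lt : ∀ c d : {c : ℕ × ℕ // c ∈ μ.cells},
    c.1.2 = d.1.2 → c.1.1 < d.1.1 → (entry c : ℕ) < entry d

namespace StandardYoungTableau

variable {μ : YoungDiagram}

theorem entry_injective :
    Function.Injective (entry : StandardYoungTableau μ → _) := by
  rintro ⟨e, _, _⟩ ⟨e', _, _⟩ h
  cases h
  rfl

noncomputable instance : Fintype (StandardYoungTableau μ) :=
  Fintype.ofInjective _ entry_injective

/-- `T` has a descent at `i`: both `i` and `i + 1` are entries of `T`, and the cell `d` of `i + 1`
lies strictly south and weakly to the west of the cell `c` of `i`. -/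
def HasDescentAt (T : StandardYoungTableau μ) (i : ℕ) : Prop :=
  ∃ c d : {c : ℕ × ℕ // c ∈ μ.cells}, (T.entry c : ℕ) = i ∧ (T.entry d : ℕ) = i + 1 ∧
    c.1.1 < d.1.1 ∧ d.1.2 ≤ c.1.2

open Classical in
/-- The descent set `D(T)`; descents can only occur at `1, …, |μ| - 1`. -/
noncomputable def descents (T : StandardYoungTableau μ) : Finset ℕ :=
  (Finset.Ico 1 μ.card).filter T.HasDescentAt

/-- Every descent belongs to the descent set, so the range used there loses nothing. -/
theorem mem_descents (T : StandardYoungTableau μ) (i : ℕ) :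
    i ∈ T.descents ↔ T.HasDescentAt i := by
  classical
  simp only [descents, Finset.mem_filter, Finset.mem_Ico, and_iff_right_iff_imp]
  rintro ⟨c, d, hc, hd, -⟩
  have h1 := Finset.mem_Icc.1 (T.entry c).2
  have h2 := Finset.mem_Icc.1 (T.entry d).2
  omega

/-- The descent function `d_f(T) = ∑_{i ∈ D(T)} f(i)`. -/
noncomputable def descentFunction (f : ℕ → ℝ) (T : StandardYoungTableau μ) : ℝ :=
  ∑ i ∈ T.descents, f i

end StandardYoungTableau

/-- Expectation of `X` over a uniformly random standard Young tableau of shape `μ`. -/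
noncomputable def tableauExpectation (μ : YoungDiagram) (X : StandardYoungTableau μ → ℝ) : ℝ :=
  (∑ T : StandardYoungTableau μ, X T) / (Fintype.card (StandardYoungTableau μ) : ℝ)

/-- Variance of `X` over a uniformly random standard Young tableau of shape `μ`. -/
noncomputable def tableauVariance (μ : YoungDiagram) (X : StandardYoungTableau μ → ℝ) : ℝ :=
  tableauExpectation μ fun T => (X T - tableauExpectation μ X) ^ 2

/-- `E_μ(d_f)`. -/
noncomputable def descentExpectation (μ : YoungDiagram) (f : ℕ → ℝ) : ℝ :=
  tableauExpectation μ (StandardYoungTableau.descentFunction f)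

/-- `V_μ(d_f)`. -/
noncomputable def descentVariance (μ : YoungDiagram) (f : ℕ → ℝ) : ℝ :=
  tableauVariance μ (StandardYoungTableau.descentFunction f)

/-! Write n = |λ|, S₁ = ∑ f(i), S₂ = ∑ f(i)², and k = n - λ₁. Dual Knuth moves are involutions on
tableaux that carry a descent at i to one at i + 1. Hence all descents have the same probability p,
and all pairs of descents at distance at least 2 have the same probability q. In particular E(d_f) =
p S₁.

The size of p is controlled by k/n: k/2 ≤ p(n - 1) ≤ k. The upper bound holds since a tableau has at
most k descents. For the lower bound, exchanging i and i + 1 shows that the content grows on average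
by 1 - 2p from one entry to the next; the total content is thus (1 - 2p) n(n - 1)/2, and it is at
most n(λ₁ - 1)/2. Bounding the squared number of descents by k² likewise gives q ≤ 32 k²/n² ≤ 128
p².

Expanding E(d_f²), close pairs contribute at most 3pS₂ and distant ones at most 128 p² S₁², while
E(d_f²) ≥ p S₂ by positivity of f. So V/E² is bounded exactly when S₂/(p S₁²) is, and p may be
replaced by k/n. For a single row p = k = 0, and both conditions fail. The bounds are
`descentProb_mul_le`, `le_descentProb_mul`, `descentProb_mul_sum_sq_le` and `descentVariance_le`. -/

namespace StandardYoungTableau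

variable {μ : YoungDiagram}

/-! ### Cells as a function of entries -/

/-- The cell of the entry `i`, with the dummy value `(0, 0)` if `i` is not an entry. -/
noncomputable def pos (T : StandardYoungTableau μ) (i : ℕ) : ℕ × ℕ :=
  if h : i ∈ Finset.Icc 1 μ.card then (T.entry.symm ⟨i, h⟩).1 else (0, 0)

theorem pos_entry (T : StandardYoungTableau μ) (c : {c : ℕ × ℕ // c ∈ μ.cells}) :
    T.pos (T.entry c) = c.1 := by
  have h := (T.entry c).2
  simp [pos, h]

theorem exists_cell (T : StandardYoungTableau μ) {i : ℕ} (hi : i ∈ Finset.Icc 1 μ.card) :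
    ∃ c : {c : ℕ × ℕ // c ∈ μ.cells}, (T.entry c : ℕ) = i ∧ T.pos i = c.1 :=
  ⟨T.entry.symm ⟨i, hi⟩, by simp, by simp only [pos, hi, dif_pos]⟩

theorem pos_mem (T : StandardYoungTableau μ) {i : ℕ} (hi : i ∈ Finset.Icc 1 μ.card) :
    T.pos i ∈ μ.cells := by
  obtain ⟨c, -, h⟩ := T.exists_cell hi
  exact h ▸ c.2

theorem exists_pos_eq (T : StandardYoungTableau μ) {c : ℕ × ℕ} (hc : c ∈ μ) :
    ∃ i ∈ Finset.Icc 1 μ.card, T.pos i = c :=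
  ⟨T.entry ⟨c, hc⟩, (T.entry ⟨c, hc⟩).2, T.pos_entry ⟨c, hc⟩⟩

theorem pos_injOn (T : StandardYoungTableau μ) :
    Set.InjOn T.pos (Finset.Icc 1 μ.card : Finset ℕ) := by
  intro i hi j hj h
  obtain ⟨c, rfl, hc⟩ := T.exists_cell hi
  obtain ⟨d, rfl, hd⟩ := T.exists_cell hj
  rw [hc, hd] at h
  rw [Subtype.ext h]

theorem ext_pos {T T' : StandardYoungTableau μ}
    (h : ∀ i ∈ Finset.Icc 1 μ.card, T.pos i = T'.pos i) : T = T' := by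
  apply entry_injective
  ext c
  have h1 := h _ (T.entry c).2
  rw [T.pos_entry] at h1
  obtain ⟨d, hd, hd'⟩ := T'.exists_cell (T.entry c).2
  rw [hd'] at h1
  rw [← hd, Subtype.ext h1]

/-- Compare both entries with the one in the row of `i` and the column of `j`; that cell lies in the
diagram. -/
theorem le_of_pos_le (T : StandardYoungTableau μ) {i j : ℕ} (hi : i ∈ Finset.Icc 1 μ.card)
    (hj : j ∈ Finset.Icc 1 μ.card) (hr : (T.pos i).1 ≤ (T.pos j).1)
    (hc : (T.pos i).2 ≤ (T.pos j).2) : i ≤ j := by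
  obtain ⟨c, rfl, hc'⟩ := T.exists_cell hi
  obtain ⟨d, rfl, hd'⟩ := T.exists_cell hj
  rw [hc', hd'] at hr hc
  have he : (c.1.1, d.1.2) ∈ μ.cells := μ.isLowerSet (a := d.1) ⟨hr, le_rfl⟩ d.2
  have h1 : (T.entry c : ℕ) ≤ T.entry ⟨_, he⟩ := by
    rcases hc.lt_or_eq with h | h
    · exact (T.row_lt c ⟨_, he⟩ rfl h).le
    · exact le_of_eq (by congr 2; exact Subtype.ext (Prod.ext rfl h))
  have h2 : (T.entry ⟨_, he⟩ : ℕ) ≤ T.entry d := by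
    rcases hr.lt_or_eq with h | h
    · exact (T.col_lt ⟨_, he⟩ d rfl h).le
    · exact le_of_eq (by congr 2; exact Subtype.ext (Prod.ext h rfl))
  exact h1.trans h2

/-- The cells weakly north-west of the cell of `j` carry entries at most `j`. -/
theorem exists_pos_eq_le (T : StandardYoungTableau μ) {j : ℕ} (hj : j ∈ Finset.Icc 1 μ.card)
    {c : ℕ × ℕ} (hr : c.1 ≤ (T.pos j).1) (hc : c.2 ≤ (T.pos j).2) :
    ∃ i ∈ Finset.Icc 1 μ.card, T.pos i = c ∧ i ≤ j := by
  obtain ⟨i, hi, h⟩ := T.exists_pos_eq (c := c) (μ.isLowerSet (a := T.pos j) ⟨hr, hc⟩ (T.pos_mem hj))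
  exact ⟨i, hi, h, T.le_of_pos_le hi hj (h ▸ hr) (h ▸ hc)⟩

theorem pos_one (T : StandardYoungTableau μ) (h : 1 ≤ μ.card) : T.pos 1 = (0, 0) := by
  obtain ⟨i, hi, h1, h2⟩ := T.exists_pos_eq_le (j := 1) (c := (0, 0)) (Finset.mem_Icc.2 ⟨le_rfl, h⟩) (by simp) (by simp)
  rw [Finset.mem_Icc] at hi
  rwa [show i = 1 by omega] at h1

/-! ### Contents and descents -/

/-- The content (column minus row) of the cell of `i`. -/
noncomputable def content (T : StandardYoungTableau μ) (i : ℕ) : ℤ :=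
  (T.pos i).2 - (T.pos i).1

/-- The relative position of the cells of `i` and `i + 1`. -/
theorem pos_succ_cases (T : StandardYoungTableau μ) {i : ℕ} (hi : 1 ≤ i) (hn : i + 1 ≤ μ.card) :
    (T.pos i).1 < (T.pos (i + 1)).1 ∧ (T.pos (i + 1)).2 ≤ (T.pos i).2 ∨
      (T.pos (i + 1)).1 ≤ (T.pos i).1 ∧ (T.pos i).2 < (T.pos (i + 1)).2 := by
  have h1 : i ∈ Finset.Icc 1 μ.card := by simp; omega
  have h2 : i + 1 ∈ Finset.Icc 1 μ.card := by simp; omega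
  have h3 := T.le_of_pos_le h2 h1
  by_contra! hcon
  -- The only other possibility is `i + 1` strictly south-east of `i`; the corner between them would
  -- then need an entry strictly between the two.
  have h4 : (T.pos i).1 < (T.pos (i + 1)).1 ∧ (T.pos i).2 < (T.pos (i + 1)).2 := by
    constructor <;> by_contra! h <;> grind
  obtain ⟨j, hj, h5, h6⟩ := T.exists_pos_eq_le h2 (c := ((T.pos i).1, (T.pos (i + 1)).2))
    h4.1.le le_rfl
  have h7 := T.le_of_pos_le h1 hj (by rw [h5]) (by rw [h5]; exact h4.2.le)
  have : j = i ∨ j = i + 1 := by omega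
  rcases this with rfl | rfl
  · simp only [Prod.ext_iff] at h5; omega
  · simp only [Prod.ext_iff] at h5; omega

theorem hasDescentAt_iff (T : StandardYoungTableau μ) {i : ℕ} (hi : 1 ≤ i)
    (hn : i + 1 ≤ μ.card) : T.HasDescentAt i ↔ T.content (i + 1) < T.content i := by
  have h1 : i ∈ Finset.Icc 1 μ.card := by simp; omega
  have h2 : i + 1 ∈ Finset.Icc 1 μ.card := by simp; omega
  have h := T.pos_succ_cases hi hn
  have key : T.HasDescentAt i ↔
      (T.pos i).1 < (T.pos (i + 1)).1 ∧ (T.pos (i + 1)).2 ≤ (T.pos i).2 := by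
    constructor
    · rintro ⟨c, d, hc, hd, h3, h4⟩
      rw [← hd, ← hc, T.pos_entry, T.pos_entry]
      exact ⟨h3, h4⟩
    · intro h3
      obtain ⟨c, hc, hc'⟩ := T.exists_cell h1
      obtain ⟨d, hd, hd'⟩ := T.exists_cell h2
      rw [hc', hd'] at h3
      exact ⟨c, d, hc, hd, h3⟩
  rw [key]
  unfold content
  omega

theorem content_succ_ne (T : StandardYoungTableau μ) {i : ℕ} (hi : 1 ≤ i)
    (hn : i + 1 ≤ μ.card) : T.content (i + 1) ≠ T.content i := by
  have h := T.pos_succ_cases hi hn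
  unfold content
  omega

/-- On a common diagonal, the other two corners of the rectangle spanned by the cells would both
need an entry strictly between `i` and `i + 2`. -/
theorem content_add_two_ne (T : StandardYoungTableau μ) {i : ℕ} (hi : 1 ≤ i)
    (hn : i + 2 ≤ μ.card) : T.content (i + 2) ≠ T.content i := by
  intro h
  unfold content at h
  have h1 : i ∈ Finset.Icc 1 μ.card := by simp; omega
  have h2 : i + 2 ∈ Finset.Icc 1 μ.card := by simp; omega
  have h3 := T.le_of_pos_le h2 h1
  have h4 : (T.pos i).1 < (T.pos (i + 2)).1 ∧ (T.pos i).2 < (T.pos (i + 2)).2 := by omega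
  obtain ⟨j, hj, h5, h6⟩ := T.exists_pos_eq_le h2 (c := ((T.pos i).1, (T.pos (i + 2)).2))
    h4.1.le le_rfl
  obtain ⟨k, hk, h7, h8⟩ := T.exists_pos_eq_le h2 (c := ((T.pos (i + 2)).1, (T.pos i).2))
    le_rfl h4.2.le
  have h9 := T.le_of_pos_le h1 hj (by rw [h5]) (by rw [h5]; exact h4.2.le)
  have h10 := T.le_of_pos_le h1 hk (by rw [h7]; exact h4.1.le) (by rw [h7])
  rw [Prod.ext_iff] at h5 h7
  have hji : j ≠ i := by rintro rfl; omega
  have hji' : j ≠ i + 2 := by rintro rfl; omega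
  have hki : k ≠ i := by rintro rfl; omega
  have hki' : k ≠ i + 2 := by rintro rfl; omega
  have : j = k := by omega
  subst this
  omega

/-- Consecutive entries in one row or one column are in adjacent cells. -/
theorem abs_content_succ_sub_eq_one (T : StandardYoungTableau μ) {i : ℕ} (hi : 1 ≤ i)
    (hn : i + 1 ≤ μ.card)
    (h : (T.pos i).1 = (T.pos (i + 1)).1 ∨ (T.pos i).2 = (T.pos (i + 1)).2) :
    |T.content (i + 1) - T.content i| = 1 := by
  have h1 : i ∈ Finset.Icc 1 μ.card := by simp; omega
  have h2 : i + 1 ∈ Finset.Icc 1 μ.card := by simp; omega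
  have hs := T.pos_succ_cases hi hn
  unfold content
  rcases h with h | h
  -- The right neighbour of the cell of `i` has an entry above `i` and at most `i + 1`.
  · obtain ⟨j, hj, h5, h6⟩ := T.exists_pos_eq_le h2 (c := ((T.pos i).1, (T.pos i).2 + 1))
      h.le (by change _ + 1 ≤ _; omega)
    have h7 := T.le_of_pos_le h1 hj (by rw [h5]) (by rw [h5]; simp)
    rw [Prod.ext_iff] at h5
    have : j ≠ i := by rintro rfl; simp at h5
    obtain rfl : j = i + 1 := by omega
    rw [abs_eq (by norm_num)]
    simp only at h5
    omega
  · obtain ⟨j, hj, h5, h6⟩ := T.exists_pos_eq_le h2 (c := ((T.pos i).1 + 1, (T.pos i).2))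
      (by change _ + 1 ≤ _; omega) h.le
    have h7 := T.le_of_pos_le h1 hj (by rw [h5]; simp) (by rw [h5])
    rw [Prod.ext_iff] at h5
    have : j ≠ i := by rintro rfl; simp at h5
    obtain rfl : j = i + 1 := by omega
    rw [abs_eq (by norm_num)]
    simp only at h5
    omega

/-! ### Exchanges and dual Knuth moves -/

/-- If `i` and `i + 1` are not in adjacent cells, exchanging them gives a tableau. -/
theorem exists_swap (T : StandardYoungTableau μ) {i : ℕ} (hi : 1 ≤ i) (hn : i + 1 ≤ μ.card)
    (h : |T.content (i + 1) - T.content i| ≠ 1) :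
    ∃ T' : StandardYoungTableau μ, ∀ j, T'.pos j = T.pos (Equiv.swap i (i + 1) j) := by
  have h1 : i ∈ Finset.Icc 1 μ.card := by simp; omega
  have h2 : i + 1 ∈ Finset.Icc 1 μ.card := by simp; omega
  have hne := mt (T.abs_content_succ_sub_eq_one hi hn) h
  push Not at hne
  let e : {i : ℕ // i ∈ Finset.Icc 1 μ.card} ≃ {i : ℕ // i ∈ Finset.Icc 1 μ.card} :=
    Equiv.swap ⟨i, h1⟩ ⟨i + 1, h2⟩
  have he : ∀ x, (e x : ℕ) = Equiv.swap i (i + 1) x := by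
    intro x
    simp only [e, Equiv.swap_apply_def, Subtype.ext_iff]
    split_ifs <;> rfl
  have key : ∀ c d : {c : ℕ × ℕ // c ∈ μ.cells}, (c.1.1 = d.1.1 ∨ c.1.2 = d.1.2) →
      (T.entry c : ℕ) < T.entry d → (e (T.entry c) : ℕ) < e (T.entry d) := by
    intro c d hcd hlt
    rw [he, he]
    -- The exchange reverses only the order of `i` and `i + 1`, which share no row or column here.
    by_cases hc : (T.entry c : ℕ) = i ∧ (T.entry d : ℕ) = i + 1
    · have hc1 := T.pos_entry c
      have hd1 := T.pos_entry d
      rw [hc.1] at hc1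
      rw [hc.2] at hd1
      rw [hc1, hd1] at hne
      exact (hcd.elim hne.1 hne.2).elim
    · simp only [Equiv.swap_apply_def]
      split_ifs <;> omega
  refine ⟨⟨T.entry.trans e, fun c d hr hc => key c d (.inl hr) (T.row_lt c d hr hc),
    fun c d hr hc => key c d (.inr hr) (T.col_lt c d hr hc)⟩, fun j => ?_⟩
  by_cases hj : j ∈ Finset.Icc 1 μ.card
  · have hj' := (e ⟨j, hj⟩).2
    rw [he] at hj'
    simp only [pos, hj, hj', dif_pos, Equiv.symm_trans_apply]
    congr 2
    exact Subtype.ext (he ⟨j, hj⟩)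
  · have hj' : Equiv.swap i (i + 1) j = j := by
      apply Equiv.swap_apply_of_ne_of_ne <;> rintro rfl <;> contradiction
    rw [hj']
    simp only [pos, hj, dif_neg, not_false_iff]

open Classical in
/-- Exchange `i` and `i + 1`, if this gives a tableau. -/
noncomputable def swap (i : ℕ) (T : StandardYoungTableau μ) : StandardYoungTableau μ :=
  if h : ∃ T' : StandardYoungTableau μ, ∀ j, T'.pos j = T.pos (Equiv.swap i (i + 1) j)
  then h.choose else T

theorem pos_swap (T : StandardYoungTableau μ) {i : ℕ} (hi : 1 ≤ i) (hn : i + 1 ≤ μ.card)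
    (h : |T.content (i + 1) - T.content i| ≠ 1) (j : ℕ) :
    (T.swap i).pos j = T.pos (Equiv.swap i (i + 1) j) := by
  have h' := T.exists_swap hi hn h
  rw [swap, dif_pos h']
  exact h'.choose_spec j

theorem content_swap (T : StandardYoungTableau μ) {i : ℕ} (hi : 1 ≤ i) (hn : i + 1 ≤ μ.card)
    (h : |T.content (i + 1) - T.content i| ≠ 1) (j : ℕ) :
    (T.swap i).content j = T.content (Equiv.swap i (i + 1) j) := by
  rw [content, T.pos_swap hi hn h, content]

theorem swap_swap (T : StandardYoungTableau μ) {i : ℕ} (hi : 1 ≤ i) (hn : i + 1 ≤ μ.card)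
    (h : |T.content (i + 1) - T.content i| ≠ 1) : (T.swap i).swap i = T := by
  apply ext_pos
  intro j _
  rw [pos_swap _ hi hn, pos_swap _ hi hn h, Equiv.swap_apply_self]
  rwa [content_swap _ hi hn h, content_swap _ hi hn h, Equiv.swap_apply_left,
    Equiv.swap_apply_right, abs_sub_comm]

open Classical in
/-- Exchange `i` and `i + 1` unless they are in adjacent cells. -/
noncomputable def adjSwap (i : ℕ) (T : StandardYoungTableau μ) : StandardYoungTableau μ :=
  if |T.content (i + 1) - T.content i| = 1 then T else T.swap i

theorem adjSwap_involutive {i : ℕ} (hi : 1 ≤ i) (hn : i + 1 ≤ μ.card) :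
    Function.Involutive (adjSwap (μ := μ) i) := by
  intro T
  by_cases h : |T.content (i + 1) - T.content i| = 1
  · simp [adjSwap, h]
  · have h' : ¬ |(T.swap i).content (i + 1) - (T.swap i).content i| = 1 := by
      rwa [content_swap _ hi hn h, content_swap _ hi hn h, Equiv.swap_apply_left,
        Equiv.swap_apply_right, abs_sub_comm]
    simp [adjSwap, h, h', swap_swap _ hi hn h]

/-- The dual Knuth move at `i, i + 1, i + 2`: if the content of `i + 1` is the largest or the
smallest of the three, exchange it with the one among `i` and `i + 2` whose content is not the
middle one. -/
noncomputable def dualKnuth (i : ℕ) (T : StandardYoungTableau μ) : StandardYoungTableau μ :=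
  if (T.content (i + 1) < T.content i ∧ T.content i < T.content (i + 2)) ∨
      (T.content (i + 2) < T.content i ∧ T.content i < T.content (i + 1)) then T.swap (i + 1)
  else if (T.content (i + 1) < T.content (i + 2) ∧ T.content (i + 2) < T.content i) ∨
      (T.content i < T.content (i + 2) ∧ T.content (i + 2) < T.content (i + 1)) then T.swap i
  else T

/-- A third content strictly between the two exchanged ones makes them differ by at least 2, so the
exchange is legal. -/
theorem content_swap_left (T : StandardYoungTableau μ) {i : ℕ} (hi : 1 ≤ i)
    (hn : i + 2 ≤ μ.card)
    (h : (T.content (i + 1) < T.content (i + 2) ∧ T.content (i + 2) < T.content i) ∨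
      (T.content i < T.content (i + 2) ∧ T.content (i + 2) < T.content (i + 1))) :
    |T.content (i + 1) - T.content i| ≠ 1 ∧
    (T.swap i).content i = T.content (i + 1) ∧ (T.swap i).content (i + 1) = T.content i ∧
      ∀ j, j ≠ i → j ≠ i + 1 → (T.swap i).content j = T.content j := by
  have h' : |T.content (i + 1) - T.content i| ≠ 1 := by
    rw [Ne, abs_eq (by norm_num)]; omega
  refine ⟨h', ?_, ?_, fun j h1 h2 => ?_⟩ <;> rw [content_swap _ hi (by omega) h']
  · rw [Equiv.swap_apply_left]
  · rw [Equiv.swap_apply_right]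
  · rw [Equiv.swap_apply_of_ne_of_ne h1 h2]

theorem content_swap_right (T : StandardYoungTableau μ) {i : ℕ} (hn : i + 2 ≤ μ.card)
    (h : (T.content (i + 1) < T.content i ∧ T.content i < T.content (i + 2)) ∨
      (T.content (i + 2) < T.content i ∧ T.content i < T.content (i + 1))) :
    |T.content (i + 1 + 1) - T.content (i + 1)| ≠ 1 ∧
    (T.swap (i + 1)).content (i + 1) = T.content (i + 2) ∧
      (T.swap (i + 1)).content (i + 2) = T.content (i + 1) ∧
      ∀ j, j ≠ i + 1 → j ≠ i + 2 → (T.swap (i + 1)).content j = T.content j := by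
  have h' : |T.content (i + 1 + 1) - T.content (i + 1)| ≠ 1 := by
    rw [Ne, abs_eq (by norm_num)]; rw [show i + 1 + 1 = i + 2 from rfl]; omega
  refine ⟨h', ?_, ?_, fun j h1 h2 => ?_⟩ <;> rw [content_swap _ (by omega) (by omega) h']
  · rw [Equiv.swap_apply_left]
  · rw [Equiv.swap_apply_right]
  · rw [Equiv.swap_apply_of_ne_of_ne h1 h2]

/-- The entry with the middle content stays in place, so the second application takes the same
branch and undoes the exchange. -/
theorem dualKnuth_involutive {i : ℕ} (hi : 1 ≤ i) (hn : i + 2 ≤ μ.card) :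
    Function.Involutive (dualKnuth (μ := μ) i) := by
  intro T
  by_cases h1 : (T.content (i + 1) < T.content i ∧ T.content i < T.content (i + 2)) ∨
      (T.content (i + 2) < T.content i ∧ T.content i < T.content (i + 1))
  · obtain ⟨h, h2, h3, h4⟩ := T.content_swap_right hn h1
    have h5 := h4 i (by omega) (by omega)
    have e : T.dualKnuth i = T.swap (i + 1) := if_pos h1
    rw [e, dualKnuth, if_pos (by rw [h2, h3, h5]; omega),
      swap_swap _ (by omega) (by omega) h]
  · by_cases h1' : (T.content (i + 1) < T.content (i + 2) ∧ T.content (i + 2) < T.content i) ∨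
      (T.content i < T.content (i + 2) ∧ T.content (i + 2) < T.content (i + 1))
    · obtain ⟨h, h2, h3, h4⟩ := T.content_swap_left hi hn h1'
      have h5 := h4 (i + 2) (by omega) (by omega)
      have e : T.dualKnuth i = T.swap i := by rw [dualKnuth, if_neg h1, if_pos h1']
      rw [e, dualKnuth, if_neg (by rw [h2, h3, h5]; omega), if_pos (by rw [h2, h3, h5]; omega),
        swap_swap _ (by omega) (by omega) h]
    · have e : T.dualKnuth i = T := by rw [dualKnuth, if_neg h1, if_neg h1']
      rw [e, e]

/-- If `i + 1` has the middle content, the three contents are monotone, so both places or neither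
are descents. Otherwise exactly one is, and the exchange switches which. -/
theorem content_dualKnuth (T : StandardYoungTableau μ) {i : ℕ} (hi : 1 ≤ i)
    (hn : i + 2 ≤ μ.card) :
    ((T.dualKnuth i).content (i + 1) < (T.dualKnuth i).content i ↔
      T.content (i + 2) < T.content (i + 1)) ∧
    ∀ j, j < i ∨ i + 2 < j → (T.dualKnuth i).content j = T.content j := by
  by_cases h1 : (T.content (i + 1) < T.content i ∧ T.content i < T.content (i + 2)) ∨
      (T.content (i + 2) < T.content i ∧ T.content i < T.content (i + 1))
  · obtain ⟨h, h2, h3, h4⟩ := T.content_swap_right hn h1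
    have h5 := h4 i (by omega) (by omega)
    have e : T.dualKnuth i = T.swap (i + 1) := if_pos h1
    rw [e, h2, h5]
    exact ⟨by omega, fun j hj => h4 j (by omega) (by omega)⟩
  · by_cases h1' : (T.content (i + 1) < T.content (i + 2) ∧ T.content (i + 2) < T.content i) ∨
      (T.content i < T.content (i + 2) ∧ T.content (i + 2) < T.content (i + 1))
    · obtain ⟨h, h2, h3, h4⟩ := T.content_swap_left hi hn h1'
      have e : T.dualKnuth i = T.swap i := by rw [dualKnuth, if_neg h1, if_pos h1']
      rw [e, h2, h3]
      exact ⟨by omega, fun j hj => h4 j (by omega) (by omega)⟩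
    · have e : T.dualKnuth i = T := by rw [dualKnuth, if_neg h1, if_neg h1']
      have h2 := T.content_succ_ne hi (by omega)
      have h3 := T.content_succ_ne (i := i + 1) (by omega) (by omega)
      have h4 := T.content_add_two_ne hi hn
      rw [show i + 1 + 1 = i + 2 from rfl] at h3
      rw [e]
      exact ⟨by omega, fun _ _ => rfl⟩

/-- The dual Knuth move exchanges descents at `i` and at `i + 1`. -/
theorem hasDescentAt_dualKnuth (T : StandardYoungTableau μ) {i : ℕ} (hi : 1 ≤ i)
    (hn : i + 2 ≤ μ.card) : (T.dualKnuth i).HasDescentAt i ↔ T.HasDescentAt (i + 1) := by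
  rw [hasDescentAt_iff _ hi (by omega), hasDescentAt_iff _ (by omega) hn]
  exact (T.content_dualKnuth hi hn).1

/-- The dual Knuth move does not affect descents that do not involve `i, i + 1, i + 2`. -/
theorem hasDescentAt_dualKnuth_of_far (T : StandardYoungTableau μ) {i j : ℕ} (hi : 1 ≤ i)
    (hn : i + 2 ≤ μ.card) (hj : 1 ≤ j) (hjn : j + 1 ≤ μ.card) (h : j + 1 < i ∨ i + 2 < j) :
    (T.dualKnuth i).HasDescentAt j ↔ T.HasDescentAt j := by
  have h' := (T.content_dualKnuth hi hn).2
  rw [hasDescentAt_iff _ hj hjn, hasDescentAt_iff _ hj hjn, h' j (by omega), h' (j + 1) (by omega)]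

/-! ### Existence of a tableau: number the cells row by row -/

instance : Nonempty (StandardYoungTableau μ) := by
  let s : Finset (ℕ ×ₗ ℕ) := μ.cells.map toLex.toEmbedding
  have hs : s.card = μ.card := by simp [s]
  let e := (s.orderIsoOfFin hs).symm
  let e1 : {c : ℕ × ℕ // c ∈ μ.cells} ≃ s := toLex.subtypeEquiv (fun c => by simp [s])
  let e2 : Fin μ.card ≃ {i : ℕ // i ∈ Finset.Icc 1 μ.card} :=
    { toFun := fun i => ⟨i + 1, by simp⟩
      invFun := fun i => ⟨i.1 - 1, by have := Finset.mem_Icc.1 i.2; omega⟩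
      left_inv := fun i => by simp
      right_inv := fun i => by
        have := Finset.mem_Icc.1 i.2
        apply Subtype.ext
        simp only
        omega }
  have key : ∀ c d : {c : ℕ × ℕ // c ∈ μ.cells}, toLex c.1 < toLex d.1 →
      (e2 (e (e1 c)) : ℕ) < e2 (e (e1 d)) := by
    intro c d h
    have : e (e1 c) < e (e1 d) := e.lt_iff_lt.2 h
    change (e (e1 c) : ℕ) + 1 < e (e1 d) + 1
    exact Nat.succ_lt_succ this
  refine ⟨⟨(e1.trans e.toEquiv).trans e2, fun c d h1 h2 => key c d ?_,
    fun c d h1 h2 => key c d ?_⟩⟩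
  · exact Prod.Lex.toLex_lt_toLex.2 (.inr ⟨h1, h2⟩)
  · exact Prod.Lex.toLex_lt_toLex.2 (.inl h2)

/-! ### Descent probabilities do not depend on the place -/

open Classical in
/-- The number of standard Young tableaux with descents at both `i` and `j`. -/
noncomputable def pairCount (μ : YoungDiagram) (i j : ℕ) : ℕ :=
  (Finset.univ.filter fun T : StandardYoungTableau μ => T.HasDescentAt i ∧ T.HasDescentAt j).card

theorem pairCount_comm (i j : ℕ) : pairCount μ i j = pairCount μ j i := by
  classical
  exact congrArg Finset.card (Finset.filter_congr fun _ _ => and_comm)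

theorem pairCount_congr {i j i' j' : ℕ} (e : StandardYoungTableau μ ≃ StandardYoungTableau μ)
    (h : ∀ T, (e T).HasDescentAt i ∧ (e T).HasDescentAt j ↔
      T.HasDescentAt i' ∧ T.HasDescentAt j') : pairCount μ i' j' = pairCount μ i j := by
  classical
  refine Finset.card_equiv e fun T => ?_
  simp [h]

theorem pairCount_self_eq {i : ℕ} (hi : 1 ≤ i) (hn : i + 1 ≤ μ.card) :
    pairCount μ i i = pairCount μ 1 1 := by
  induction i, hi using Nat.le_induction with
  | base => rfl
  | succ i hi ih =>
    rw [← ih (by omega)]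
    exact pairCount_congr (dualKnuth_involutive hi hn).toPerm fun T => by
      simp [hasDescentAt_dualKnuth T hi hn]

/-- Move the smaller place down to 1, then the larger down to 3; the gap keeps each dual Knuth move
away from the other descent. -/
theorem pairCount_eq_of_add_two_le {i j : ℕ} (hi : 1 ≤ i) (hij : i + 2 ≤ j)
    (hn : j + 1 ≤ μ.card) : pairCount μ i j = pairCount μ 1 3 := by
  have h1 : pairCount μ i j = pairCount μ 1 j := by
    induction i, hi using Nat.le_induction with
    | base => rfl
    | succ i hi ih =>
      rw [← ih (by omega)]
      exact pairCount_congr (dualKnuth_involutive hi (by omega)).toPerm fun T => by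
        rw [Function.Involutive.coe_toPerm, hasDescentAt_dualKnuth T hi (by omega),
          hasDescentAt_dualKnuth_of_far T hi (by omega) (by omega) hn (by omega)]
  rw [h1]
  have hj : 3 ≤ j := by omega
  clear h1 hij
  induction j, hj using Nat.le_induction with
  | base => rfl
  | succ j hj ih =>
    rw [← ih (by omega)]
    exact pairCount_congr (dualKnuth_involutive (by omega) hn).toPerm fun T => by
      rw [Function.Involutive.coe_toPerm, hasDescentAt_dualKnuth T (by omega) hn,
        hasDescentAt_dualKnuth_of_far T (by omega) hn (by omega) (by omega) (by omega)]

theorem pairCount_le (i j : ℕ) : pairCount μ i j ≤ pairCount μ i i := by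
  classical
  apply Finset.card_le_card
  intro T
  simp +contextual

/-! ### Lower bound for the descent probability by mean contents -/

-- The content step minus its sign is odd under `adjSwap`: it vanishes for adjacent cells, and
-- otherwise the exchange negates both terms. Its sum over all tableaux is therefore zero.
open Classical in
theorem hasDescentAt_adjSwap (T : StandardYoungTableau μ) {i : ℕ} (hi : 1 ≤ i)
    (hn : i + 1 ≤ μ.card) :
    ((T.adjSwap i).content (i + 1) - (T.adjSwap i).content i -
        (1 - 2 * if (T.adjSwap i).HasDescentAt i then 1 else 0) : ℤ) =
      -(T.content (i + 1) - T.content i - (1 - 2 * if T.HasDescentAt i then 1 else 0)) := by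
  have hne := T.content_succ_ne hi hn
  by_cases h : |T.content (i + 1) - T.content i| = 1
  · have e : T.adjSwap i = T := if_pos h
    rw [e]
    rw [abs_eq (by norm_num)] at h
    simp only [hasDescentAt_iff _ hi hn]
    split_ifs <;> omega
  · have e : T.adjSwap i = T.swap i := if_neg h
    simp only [e, hasDescentAt_iff _ hi hn, content_swap T hi hn h, Equiv.swap_apply_left,
      Equiv.swap_apply_right]
    split_ifs <;> omega

theorem sum_content_succ_sub {i : ℕ} (hi : 1 ≤ i) (hn : i + 1 ≤ μ.card) :
    ∑ T : StandardYoungTableau μ, (T.content (i + 1) - T.content i) =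
      Fintype.card (StandardYoungTableau μ) - 2 * (pairCount μ 1 1 : ℤ) := by
  classical
  let F : StandardYoungTableau μ → ℤ := fun T =>
    T.content (i + 1) - T.content i - (1 - 2 * if T.HasDescentAt i then 1 else 0)
  have h : ∑ T, F T = -∑ T, F T := by
    rw [← Finset.sum_neg_distrib]
    refine (Equiv.sum_comp (adjSwap_involutive hi hn).toPerm F).symm.trans ?_
    exact Finset.sum_congr rfl fun T _ => hasDescentAt_adjSwap T hi hn
  have h0 : ∑ T, F T = 0 := by linarith
  rw [Finset.sum_sub_distrib, sub_eq_zero] at h0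
  rw [h0, Finset.sum_sub_distrib, ← Finset.mul_sum, ← pairCount_self_eq hi hn]
  simp [pairCount]

theorem sum_content_entry {j : ℕ} (hj : j + 1 ≤ μ.card) :
    ∑ T : StandardYoungTableau μ, T.content (j + 1) =
      j * (Fintype.card (StandardYoungTableau μ) - 2 * (pairCount μ 1 1 : ℤ)) := by
  induction j with
  | zero =>
    have : ∀ T : StandardYoungTableau μ, T.content 1 = 0 := fun T => by
      simp [content, T.pos_one hj]
    simp [this]
  | succ j ih =>
    have h := sum_content_succ_sub (μ := μ) (i := j + 1) (by omega) (by omega)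
    rw [Finset.sum_sub_distrib, ih (by omega)] at h
    push_cast
    linarith

theorem sum_pos {M : Type*} [AddCommMonoid M] (T : StandardYoungTableau μ) (g : ℕ × ℕ → M) :
    ∑ i ∈ Finset.range μ.card, g (T.pos (i + 1)) = ∑ c ∈ μ.cells, g c := by
  refine Finset.sum_nbij (fun i => T.pos (i + 1)) (fun i hi => ?_) (fun i hi j hj h => ?_)
    (fun c hc => ?_) (fun _ _ => rfl)
  · exact T.pos_mem (by simp at hi ⊢; omega)
  · have := T.pos_injOn (by simp at hi ⊢; omega) (by simp at hj ⊢; omega) h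
    omega
  · obtain ⟨i, hi, h⟩ := T.exists_pos_eq (Finset.mem_coe.1 hc)
    rw [Finset.mem_Icc] at hi
    exact ⟨i - 1, by simp; omega, by simpa [show i - 1 + 1 = i by omega] using h⟩

theorem two_mul_sum_snd_le : 2 * ∑ c ∈ μ.cells, (c.2 : ℤ) ≤ μ.card * (μ.rowLen 0 - 1) := by
  -- Reversing each row shows that column indices average to half of the row length minus one.
  have h : ∑ c ∈ μ.cells, (c.2 : ℤ) = ∑ c ∈ μ.cells, ((μ.rowLen c.1 : ℤ) - 1 - c.2) := by
    refine Finset.sum_nbij' (fun c => (c.1, μ.rowLen c.1 - 1 - c.2))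
      (fun c => (c.1, μ.rowLen c.1 - 1 - c.2)) ?_ ?_ ?_ ?_ ?_ <;> rintro ⟨r, q⟩ hc <;>
      have hlt := YoungDiagram.mem_iff_lt_rowLen.1 ((YoungDiagram.mem_cells _).1 hc)
    · rw [YoungDiagram.mem_cells, YoungDiagram.mem_iff_lt_rowLen]; change μ.rowLen r - 1 - q < μ.rowLen r; omega
    · rw [YoungDiagram.mem_cells, YoungDiagram.mem_iff_lt_rowLen]; change μ.rowLen r - 1 - q < μ.rowLen r; omega
    · simp; omega
    · simp; omega
    · simp only; omega
  have h2 : ∑ c ∈ μ.cells, ((μ.rowLen c.1 : ℤ) - 1) ≤ ∑ c ∈ μ.cells, ((μ.rowLen 0 : ℤ) - 1) :=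
    Finset.sum_le_sum fun c _ => by
      have := μ.rowLen_anti 0 c.1 (by omega)
      omega
  rw [Finset.sum_sub_distrib] at h
  rw [Finset.sum_const, nsmul_eq_mul] at h2
  change _ ≤ (μ.cells.card : ℤ) * _
  linarith

/-- A lower bound for the probability of a descent, from the expected contents of the entries. -/
theorem card_mul_le_two_mul_pairCount (hn : 2 ≤ μ.card) :
    (Fintype.card (StandardYoungTableau μ) : ℤ) * (μ.card - μ.rowLen 0) ≤
      2 * pairCount μ 1 1 * (μ.card - 1) := by
  set N : ℤ := (Fintype.card (StandardYoungTableau μ) : ℤ)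
  set A : ℤ := (pairCount μ 1 1 : ℤ)
  have h1 : ∑ T : StandardYoungTableau μ, ∑ j ∈ Finset.range μ.card, T.content (j + 1) ≤
      N * ∑ c ∈ μ.cells, (c.2 : ℤ) := by
    rw [show N * ∑ c ∈ μ.cells, (c.2 : ℤ) =
      ∑ _T : StandardYoungTableau μ, ∑ c ∈ μ.cells, (c.2 : ℤ) by simp [N]]
    refine Finset.sum_le_sum fun T _ => ?_
    rw [← T.sum_pos fun c => (c.2 : ℤ)]
    exact Finset.sum_le_sum fun i _ => by unfold content; omega
  rw [Finset.sum_comm, Finset.sum_congr rfl fun j hj =>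
    sum_content_entry (by rw [Finset.mem_range] at hj; omega), ← Finset.sum_mul] at h1
  have h2 : 2 * ∑ j ∈ Finset.range μ.card, (j : ℤ) = μ.card * (μ.card - 1) := by
    have := Finset.sum_range_id_mul_two μ.card
    zify at this
    rw [Nat.cast_sub (by omega)] at this
    push_cast at this
    linarith
  have hN : 0 ≤ N := by positivity
  have h3 := mul_le_mul_of_nonneg_left (two_mul_sum_snd_le (μ := μ)) hN
  have h4 : (μ.card : ℤ) * ((μ.card - 1) * (N - 2 * A)) ≤ μ.card * (N * (μ.rowLen 0 - 1)) := by
    calc _ = 2 * (∑ j ∈ Finset.range μ.card, (j : ℤ)) * (N - 2 * A) := by rw [h2]; ring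
      _ ≤ _ := by linarith
  have h5 := le_of_mul_le_mul_left h4 (by omega)
  linarith

/-! ### Upper bounds from the number of descents -/

theorem rowLen_zero_le_card : μ.rowLen 0 ≤ μ.card := by
  rw [YoungDiagram.rowLen_eq_card]
  exact Finset.card_le_card (Finset.filter_subset _ _)

/-- Every descent puts a cell below the first row. -/
theorem card_descents_add_rowLen_le (T : StandardYoungTableau μ) :
    T.descents.card + μ.rowLen 0 ≤ μ.card := by
  have h : T.descents.card ≤ (μ.cells.filter fun c => ¬ c.1 = 0).card := by
    refine Finset.card_le_card_of_injOn (fun i => T.pos (i + 1)) (fun i hi => ?_)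
      (fun i hi j hj h => ?_)
    · obtain ⟨c, d, hc, hd, h1, h2⟩ := (T.mem_descents i).1 hi
      simp only [← hd, T.pos_entry, Finset.coe_filter, Set.mem_ofPred_eq]
      exact ⟨d.2, by omega⟩
    · simp only [descents, Finset.coe_filter, Finset.mem_Ico, Set.mem_ofPred_eq] at hi hj
      have := T.pos_injOn (by simp; omega) (by simp; omega) h
      omega
  have h2 := Finset.card_filter_add_card_filter_not (s := μ.cells) (fun c => c.1 = 0)
  rw [YoungDiagram.rowLen_eq_card]
  change _ + (μ.cells.filter fun c => c.1 = 0).card ≤ μ.cells.card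
  omega

open Classical in
theorem descents_eq (T : StandardYoungTableau μ) :
    T.descents = (Finset.Ico 1 μ.card).filter T.HasDescentAt := by
  ext i
  simp [descents]

theorem sum_descents (f : ℕ → ℝ) :
    ∑ T : StandardYoungTableau μ, T.descentFunction f =
      pairCount μ 1 1 * ∑ i ∈ Finset.Ico 1 μ.card, f i := by
  classical
  simp only [descentFunction, descents_eq, Finset.sum_filter]
  rw [Finset.sum_comm, Finset.mul_sum]
  refine Finset.sum_congr rfl fun i hi => ?_
  rw [Finset.mem_Ico] at hi
  rw [← Finset.sum_filter, Finset.sum_const, nsmul_eq_mul, ← pairCount_self_eq hi.1 hi.2]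
  simp [pairCount]

theorem sum_descents_sq (f : ℕ → ℝ) :
    ∑ T : StandardYoungTableau μ, T.descentFunction f ^ 2 =
      ∑ i ∈ Finset.Ico 1 μ.card, ∑ j ∈ Finset.Ico 1 μ.card, pairCount μ i j * (f i * f j) := by
  classical
  simp only [descentFunction, descents_eq, Finset.sum_filter, sq, Finset.sum_mul_sum]
  rw [Finset.sum_comm]
  refine Finset.sum_congr rfl fun i hi => ?_
  rw [Finset.sum_comm]
  refine Finset.sum_congr rfl fun j hj => ?_
  rw [pairCount, ← nsmul_eq_mul, ← Finset.sum_const, Finset.sum_filter]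
  refine Finset.sum_congr rfl fun T _ => ?_
  split_ifs <;> simp_all

/-- This is the mean number of descents, the case `f = 1`, bounded by the number of cells below the
first row. -/
theorem pairCount_mul_le (hn : 2 ≤ μ.card) :
    (pairCount μ 1 1 : ℝ) * (μ.card - 1) ≤
      Fintype.card (StandardYoungTableau μ) * (μ.card - μ.rowLen 0) := by
  have h := sum_descents (μ := μ) 1
  simp only [Pi.one_apply, Finset.sum_const, Nat.card_Ico, nsmul_eq_mul, mul_one] at h
  rw [Nat.cast_sub (by omega), Nat.cast_one] at h
  rw [← h, ← nsmul_eq_mul, ← Finset.card_univ, ← Finset.sum_const]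
  refine Finset.sum_le_sum fun T _ => ?_
  have := T.card_descents_add_rowLen_le
  rw [le_sub_iff_add_le]
  simp only [descentFunction, Pi.one_apply, Finset.sum_const, nsmul_eq_mul, mul_one]
  exact_mod_cast this

/-- An upper bound for the probability of descents at two distant places. -/
theorem pairCount_one_three_mul_le (hn : 4 ≤ μ.card) :
    (pairCount μ 1 3 : ℝ) * μ.card ^ 2 ≤
      32 * (Fintype.card (StandardYoungTableau μ) * (μ.card - μ.rowLen 0 : ℝ) ^ 2) := by
  set n := μ.card with hn'
  -- Sizes of two blocks of places, `1, …, a` and `a + 2, …, n - 1`; every pair across them has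
  -- distance at least 2.
  obtain ⟨a, b, hab, ha, hb⟩ : ∃ a b : ℕ, a + b + 2 = n ∧ n ≤ 2 * a + 3 ∧ n ≤ 2 * b + 2 :=
    ⟨(n - 2) / 2, n - 2 - (n - 2) / 2, by omega, by omega, by omega⟩
  have h1 : (pairCount μ 1 3 : ℝ) * (a * b) ≤
      ∑ T : StandardYoungTableau μ, T.descentFunction 1 ^ 2 := by
    rw [sum_descents_sq, ← Finset.sum_product']
    calc (pairCount μ 1 3 : ℝ) * (a * b)
        = ∑ p ∈ Finset.Ico 1 (a + 1) ×ˢ Finset.Ico (a + 2) n, (pairCount μ p.1 p.2 : ℝ) := by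
          rw [Finset.sum_congr rfl fun p hp => ?_, Finset.sum_const, Finset.card_product,
            Nat.card_Ico, Nat.card_Ico, nsmul_eq_mul, mul_comm]
          · congr 1
            rw [show n - (a + 2) = b by omega]
            simp
          · simp only [Finset.mem_product, Finset.mem_Ico] at hp
            rw [pairCount_eq_of_add_two_le (by omega) (by omega) (by omega)]
      _ ≤ _ := by
          simp only [Pi.one_apply, mul_one]
          refine Finset.sum_le_sum_of_subset_of_nonneg ?_ fun _ _ _ => Nat.cast_nonneg _
          apply Finset.product_subset_product <;> apply Finset.Ico_subset_Ico <;> omega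
  have h2 : ∑ T : StandardYoungTableau μ, T.descentFunction 1 ^ 2 ≤
      Fintype.card (StandardYoungTableau μ) * (n - μ.rowLen 0 : ℝ) ^ 2 := by
    rw [← nsmul_eq_mul, ← Finset.card_univ, ← Finset.sum_const]
    refine Finset.sum_le_sum fun T _ => ?_
    have := T.card_descents_add_rowLen_le
    simp only [descentFunction, Pi.one_apply, Finset.sum_const, nsmul_eq_mul, mul_one]
    apply pow_le_pow_left₀ (Nat.cast_nonneg _)
    rw [le_sub_iff_add_le]
    exact_mod_cast this
  have h3 : (n : ℝ) ^ 2 ≤ 32 * (a * b) := by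
    have h4 : n ≤ 4 * b := by omega
    have h5 : n ≤ 8 * a := by omega
    calc (n : ℝ) ^ 2 = n * n := sq _
      _ ≤ (8 * a) * (4 * b) := by gcongr <;> exact_mod_cast ‹_›
      _ = _ := by ring
  calc (pairCount μ 1 3 : ℝ) * n ^ 2 ≤ pairCount μ 1 3 * (32 * (a * b)) := by gcongr
    _ ≤ _ := by linarith

/-! ### Second moment of the descent function -/

theorem descentFunction_nonneg {f : ℕ → ℝ} (hf : ∀ i, 1 ≤ i → 0 < f i)
    (T : StandardYoungTableau μ) {i : ℕ} (hi : i ∈ T.descents) : 0 ≤ f i := by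
  simp only [descents, Finset.mem_filter, Finset.mem_Ico] at hi
  exact (hf i hi.1.1).le

theorem sum_descents_sq_ge {f : ℕ → ℝ} (hf : ∀ i, 1 ≤ i → 0 < f i) :
    pairCount μ 1 1 * ∑ i ∈ Finset.Ico 1 μ.card, f i ^ 2 ≤
      ∑ T : StandardYoungTableau μ, T.descentFunction f ^ 2 := by
  rw [← sum_descents fun i => f i ^ 2]
  refine Finset.sum_le_sum fun T _ => ?_
  simp only [descentFunction]
  exact Finset.sum_sq_le_sq_sum_of_nonneg fun i hi => descentFunction_nonneg hf T hi

theorem sum_close_le (I : Finset ℕ) (g : ℕ → ℝ) (hg : ∀ i ∈ I, 0 ≤ g i) :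
    ∑ i ∈ I, ∑ j ∈ I, (if i ≤ j + 1 ∧ j ≤ i + 1 then g i else 0) ≤ 3 * ∑ i ∈ I, g i := by
  rw [Finset.mul_sum]
  refine Finset.sum_le_sum fun i hi => ?_
  rw [← Finset.sum_filter, Finset.sum_const, nsmul_eq_mul]
  refine mul_le_mul_of_nonneg_right ?_ (hg i hi)
  have : (I.filter fun j => i ≤ j + 1 ∧ j ≤ i + 1).card ≤ 3 := by
    refine (Finset.card_le_card (t := Finset.Icc (i - 1) (i + 1)) ?_).trans ?_
    · intro j hj
      simp only [Finset.mem_filter, Finset.mem_Icc] at hj ⊢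
      omega
    · rw [Nat.card_Icc]; omega
  exact_mod_cast this

/-- Pairs at distance at most 1 are bounded by a single descent count and `f i * f j ≤ (f i ^ 2 + f
j ^ 2) / 2`, each place having at most three partners. Distant pairs exist only for `4 ≤ μ.card`,
whence the guard in `h`. -/
theorem sum_descents_sq_le {f : ℕ → ℝ} (hf : ∀ i, 1 ≤ i → 0 < f i) {B : ℝ} (hB : 0 ≤ B)
    (h : 4 ≤ μ.card → (pairCount μ 1 3 : ℝ) ≤ B) :
    ∑ T : StandardYoungTableau μ, T.descentFunction f ^ 2 ≤
      3 * (pairCount μ 1 1 * ∑ i ∈ Finset.Ico 1 μ.card, f i ^ 2) +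
        B * (∑ i ∈ Finset.Ico 1 μ.card, f i) ^ 2 := by
  set I := Finset.Ico 1 μ.card with hI
  set A : ℝ := (pairCount μ 1 1 : ℝ)
  have hA : 0 ≤ A := Nat.cast_nonneg _
  have hc := sum_close_le I (fun i => A * f i ^ 2) fun i _ => by positivity
  have hc' : ∑ i ∈ I, ∑ j ∈ I, (if i ≤ j + 1 ∧ j ≤ i + 1 then A * f j ^ 2 else 0) ≤
      3 * ∑ i ∈ I, A * f i ^ 2 := by
    rw [Finset.sum_comm]
    simpa only [and_comm] using hc
  rw [sum_descents_sq, sq (∑ i ∈ I, f i), Finset.sum_mul_sum]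
  have key : ∀ i ∈ I, ∀ j ∈ I, (pairCount μ i j : ℝ) * (f i * f j) ≤
      (if i ≤ j + 1 ∧ j ≤ i + 1 then A * f i ^ 2 else 0) / 2 +
      (if i ≤ j + 1 ∧ j ≤ i + 1 then A * f j ^ 2 else 0) / 2 + B * (f i * f j) := by
    intro i hi j hj
    rw [hI, Finset.mem_Ico] at hi hj
    have hfi := hf i hi.1
    have hfj := hf j hj.1
    split_ifs with hij
    · have h1 : (pairCount μ i j : ℝ) ≤ A := by
        have := pairCount_le (μ := μ) i j
        rw [pairCount_self_eq hi.1 hi.2] at this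
        exact Nat.cast_le.2 this
      have h2 : (pairCount μ i j : ℝ) * (f i * f j) ≤ A * (f i * f j) := by gcongr
      have h3 : A * (f i * f j) ≤ A * ((f i ^ 2 + f j ^ 2) / 2) := by
        gcongr
        nlinarith [sq_nonneg (f i - f j)]
      have h4 : 0 ≤ B * (f i * f j) := by positivity
      linarith
    · have h1 : pairCount μ i j = pairCount μ 1 3 := by
        rcases le_total i j with h' | h'
        · exact pairCount_eq_of_add_two_le hi.1 (by omega) hj.2
        · rw [pairCount_comm]
          exact pairCount_eq_of_add_two_le hj.1 (by omega) hi.2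
      rw [h1]
      have h2 := h (by omega)
      have : (pairCount μ 1 3 : ℝ) * (f i * f j) ≤ B * (f i * f j) := by gcongr
      linarith
  refine (Finset.sum_le_sum fun i hi => Finset.sum_le_sum fun j hj => key i hi j hj).trans ?_
  simp only [Finset.sum_add_distrib, ← Finset.sum_div, ← Finset.mul_sum] at hc hc' ⊢
  linarith

/-! ### Bounds for expectation and variance -/

theorem descentVariance_eq (f : ℕ → ℝ) :
    descentVariance μ f = (∑ T : StandardYoungTableau μ, T.descentFunction f ^ 2) /
      Fintype.card (StandardYoungTableau μ) - descentExpectation μ f ^ 2 := by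
  have hN : (Fintype.card (StandardYoungTableau μ) : ℝ) ≠ 0 :=
    Nat.cast_ne_zero.2 Fintype.card_ne_zero
  have hE : ∑ T : StandardYoungTableau μ, T.descentFunction f =
      descentExpectation μ f * Fintype.card (StandardYoungTableau μ) := by
    rw [descentExpectation, tableauExpectation, div_mul_cancel₀ _ hN]
  rw [descentVariance, tableauVariance, ← descentExpectation, tableauExpectation]
  simp only [sub_sq, Finset.sum_add_distrib, Finset.sum_sub_distrib, ← Finset.sum_mul,
    ← Finset.mul_sum, hE, Finset.sum_const, Finset.card_univ, nsmul_eq_mul]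
  field_simp
  ring

theorem descentVariance_nonneg (f : ℕ → ℝ) : 0 ≤ descentVariance μ f :=
  div_nonneg (Finset.sum_nonneg fun _ _ => sq_nonneg _) (Nat.cast_nonneg _)

/-- The probability that a random standard Young tableau has a descent at a given place. -/
noncomputable def descentProb (μ : YoungDiagram) : ℝ :=
  pairCount μ 1 1 / Fintype.card (StandardYoungTableau μ)

theorem card_pos_real : (0 : ℝ) < Fintype.card (StandardYoungTableau μ) :=
  Nat.cast_pos.2 Fintype.card_pos

theorem descentExpectation_eq (f : ℕ → ℝ) :
    descentExpectation μ f = descentProb μ * ∑ i ∈ Finset.Ico 1 μ.card, f i := by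
  rw [descentExpectation, tableauExpectation, sum_descents, descentProb, div_mul_eq_mul_div]

theorem descentProb_nonneg : 0 ≤ descentProb μ :=
  div_nonneg (Nat.cast_nonneg _) (Nat.cast_nonneg _)

theorem descentProb_mul_le (hn : 2 ≤ μ.card) :
    descentProb μ * (μ.card - 1) ≤ μ.card - μ.rowLen 0 := by
  have h := pairCount_mul_le hn
  rw [descentProb, div_mul_eq_mul_div, div_le_iff₀ card_pos_real]
  linarith

theorem le_descentProb_mul (hn : 2 ≤ μ.card) :
    (μ.card - μ.rowLen 0 : ℝ) ≤ 2 * descentProb μ * (μ.card - 1) := by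
  have h : (Fintype.card (StandardYoungTableau μ) : ℝ) * (μ.card - μ.rowLen 0) ≤
      2 * pairCount μ 1 1 * (μ.card - 1) := by
    exact_mod_cast card_mul_le_two_mul_pairCount hn
  rw [descentProb, mul_div_assoc', div_mul_eq_mul_div, le_div_iff₀ card_pos_real]
  linarith

theorem descentProb_mul_sum_sq_le {f : ℕ → ℝ} (hf : ∀ i, 1 ≤ i → 0 < f i) :
    descentProb μ * ∑ i ∈ Finset.Ico 1 μ.card, f i ^ 2 ≤
      descentVariance μ f + descentExpectation μ f ^ 2 := by
  rw [descentVariance_eq, sub_add_cancel, descentProb, div_mul_eq_mul_div]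
  exact div_le_div_of_nonneg_right (sum_descents_sq_ge hf) (Nat.cast_nonneg _)

theorem descentVariance_le {f : ℕ → ℝ} (hf : ∀ i, 1 ≤ i → 0 < f i) (hn : 2 ≤ μ.card) :
    descentVariance μ f ≤ 3 * (descentProb μ * ∑ i ∈ Finset.Ico 1 μ.card, f i ^ 2) +
      128 * descentExpectation μ f ^ 2 := by
  have hN := card_pos_real (μ := μ)
  set N : ℝ := (Fintype.card (StandardYoungTableau μ) : ℝ)
  have hp := descentProb_nonneg (μ := μ)
  have hn' : (2 : ℝ) ≤ μ.card := by exact_mod_cast hn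
  have hk : (0 : ℝ) ≤ μ.card - μ.rowLen 0 := by
    rw [sub_nonneg]; exact_mod_cast rowLen_zero_le_card
  -- The constant is 128 = 32 · 2²: 32 from the pair bound, 2 from bounding `n - λ₁` by `2 * p * n`.
  have h := sum_descents_sq_le (μ := μ) (B := 128 * (N * descentProb μ ^ 2)) hf (by positivity) (by
    intro h4
    have h1 := pairCount_one_three_mul_le h4
    have h2 : (μ.card - μ.rowLen 0 : ℝ) ≤ 2 * descentProb μ * μ.card :=
      (le_descentProb_mul hn).trans (by gcongr; linarith)
    refine le_of_mul_le_mul_right ?_ (show (0 : ℝ) < μ.card ^ 2 by positivity)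
    calc _ ≤ _ := h1
      _ ≤ 32 * (N * (2 * descentProb μ * μ.card) ^ 2) := by gcongr
      _ = _ := by ring)
  have h' : (∑ T : StandardYoungTableau μ, T.descentFunction f ^ 2) / N ≤
      3 * (descentProb μ * ∑ i ∈ Finset.Ico 1 μ.card, f i ^ 2) +
      128 * descentExpectation μ f ^ 2 := by
    rw [div_le_iff₀ hN, descentExpectation_eq]
    have : (pairCount μ 1 1 : ℝ) = descentProb μ * N := by
      rw [descentProb, div_mul_cancel₀ _ hN.ne']
    rw [this] at h
    linarith
  rw [descentVariance_eq]
  have := sq_nonneg (descentExpectation μ f)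
  linarith

end StandardYoungTableau

/-! ### The equivalence -/

open StandardYoungTableau in
/-- Here `(lam m).card = n` and `(lam m).rowLen 0` is the largest part of the `m`-th partition. -/
theorem theorem2p3 (f : ℕ → ℝ) (hf : ∀ i : ℕ, 1 ≤ i → 0 < f i)
    (lam : ℕ → YoungDiagram) (hlam : ∀ m : ℕ, 2 ≤ (lam m).card) :
    ((∀ m : ℕ, descentExpectation (lam m) f ≠ 0) ∧
      ∃ C : ℝ, ∀ m : ℕ,
        |descentVariance (lam m) f / descentExpectation (lam m) f ^ 2| ≤ C) ↔
    ∃ c : ℝ, ∀ m : ℕ,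
      ((lam m).card : ℝ) * ∑ i ∈ Finset.Ico 1 (lam m).card, f i ^ 2 ≤
        c * (((lam m).card : ℝ) - ((lam m).rowLen 0 : ℝ)) *
          (∑ i ∈ Finset.Ico 1 (lam m).card, f i) ^ 2 := by
  have hS1 : ∀ m, 0 < ∑ i ∈ Finset.Ico 1 (lam m).card, f i := fun m =>
    Finset.sum_pos (fun i hi => hf i (Finset.mem_Ico.1 hi).1)
      ⟨1, Finset.mem_Ico.2 ⟨le_rfl, hlam m⟩⟩
  have hS2 : ∀ m, 0 < ∑ i ∈ Finset.Ico 1 (lam m).card, f i ^ 2 := fun m =>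
    Finset.sum_pos (fun i hi => pow_pos (hf i (Finset.mem_Ico.1 hi).1) 2)
      ⟨1, Finset.mem_Ico.2 ⟨le_rfl, hlam m⟩⟩
  have hn : ∀ m, (2 : ℝ) ≤ (lam m).card := fun m => by exact_mod_cast hlam m
  have hk : ∀ m, (0 : ℝ) ≤ (lam m).card - (lam m).rowLen 0 := fun m => by
    rw [sub_nonneg]; exact_mod_cast rowLen_zero_le_card
  have hp := fun m => descentProb_nonneg (μ := lam m)
  constructor
  · rintro ⟨hE, C, hC⟩
    -- The factor 2 comes from `n ≤ 2 * (n - 1)`, and `C + 1` from passing from the variance to the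
    -- second moment.
    refine ⟨2 * (C + 1), fun m => ?_⟩
    have hC0 : 0 ≤ C := (abs_nonneg _).trans (hC m)
    have h1 := (le_abs_self _).trans (hC m)
    rw [div_le_iff₀ (by have := hE m; positivity)] at h1
    have h2 := descentProb_mul_sum_sq_le (μ := lam m) hf
    have h3 := descentProb_mul_le (hlam m)
    have hE' := hE m
    rw [descentExpectation_eq] at h1 h2 hE'
    have hp' := (hp m).lt_of_ne' (left_ne_zero_of_mul hE')
    set S1 := ∑ i ∈ Finset.Ico 1 (lam m).card, f i
    set S2 := ∑ i ∈ Finset.Ico 1 (lam m).card, f i ^ 2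
    set p := descentProb (lam m)
    have h4 : S2 ≤ (C + 1) * p * S1 ^ 2 := by
      refine le_of_mul_le_mul_left (a := p) ?_ hp'
      linarith
    have hn' := hn m
    calc ((lam m).card : ℝ) * S2 ≤ (2 * ((lam m).card - 1)) * ((C + 1) * p * S1 ^ 2) := by
          gcongr <;> linarith
      _ = 2 * (C + 1) * (p * ((lam m).card - 1)) * S1 ^ 2 := by ring
      _ ≤ _ := by gcongr
  · rintro ⟨c, hc⟩
    -- A single row would make the right side of the inequality zero and leave the left side
    -- positive.
    have hk' : ∀ m, (0 : ℝ) < (lam m).card - (lam m).rowLen 0 := fun m => by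
      refine (hk m).lt_of_ne' fun h0 => ?_
      have h1 := hc m
      rw [h0, mul_zero, zero_mul] at h1
      exact h1.not_gt (mul_pos (by linarith [hn m]) (hS2 m))
    have hp' : ∀ m, 0 < descentProb (lam m) := fun m => by
      refine (hp m).lt_of_ne' fun h0 => ?_
      have h1 := le_descentProb_mul (hlam m)
      rw [h0] at h1
      linarith [hk' m]
    have hE : ∀ m, 0 < descentExpectation (lam m) f := fun m => by
      rw [descentExpectation_eq]
      exact mul_pos (hp' m) (hS1 m)
    -- The inequality gives `S2 ≤ 2 * c * p * S1 ^ 2`, to be inserted into `3 * (p * S2) + 128 * (p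
    -- * S1) ^ 2`.
    refine ⟨fun m => (hE m).ne', 6 * c + 128, fun m => ?_⟩
    rw [abs_of_nonneg (div_nonneg (descentVariance_nonneg f) (sq_nonneg _)),
      div_le_iff₀ (pow_pos (hE m) 2)]
    refine (descentVariance_le hf (hlam m)).trans ?_
    have h1 := le_descentProb_mul (hlam m)
    have h2 := hc m
    rw [descentExpectation_eq]
    have hS2' := hS2 m
    have hS1' := hS1 m
    have hn' := hn m
    have hk'' := hk' m
    have hpm := hp' m
    set S1 := ∑ i ∈ Finset.Ico 1 (lam m).card, f i
    set S2 := ∑ i ∈ Finset.Ico 1 (lam m).card, f i ^ 2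
    set p := descentProb (lam m)
    set n : ℝ := ((lam m).card : ℝ)
    have hc0 : 0 < c := by
      by_contra! hcon
      have : c * (n - (lam m).rowLen 0) * S1 ^ 2 ≤ 0 :=
        mul_nonpos_of_nonpos_of_nonneg (mul_nonpos_of_nonpos_of_nonneg hcon hk''.le) (sq_nonneg _)
      exact (h2.trans this).not_gt (by positivity)
    have h3 : S2 ≤ 2 * c * p * S1 ^ 2 := by
      refine le_of_mul_le_mul_left (a := n) ?_ (by linarith)
      calc n * S2 ≤ _ := h2
        _ ≤ c * (2 * p * n) * S1 ^ 2 := by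
            gcongr
            exact h1.trans (by gcongr; linarith)
        _ = _ := by ring
    have h4 : p * S2 ≤ p * (2 * c * p * S1 ^ 2) := by gcongr
    linarith
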